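/- Let $d>2$ and let $\mathbb S^d\subset\mathbb R^{d+1}$ be the unit sphere. A set $C\subseteq\mathbb S^d$ is spherically convex if it lies in an open hemisphere and contains, with any two of its points, the shorter great-circle arc (spherical segment) connecting them; a convex body in $\mathbb S^d$ is a compact spherically convex set with nonempty interior (interior and boundary are relative to $\mathbb S^d$). A boundary point $q$ of a convex body $K\subset\mathbb S^d$ is illuminated from $p\in\mathbb S^d\setminus K$ if $q\neq -p$, the spherical segment with endpoints $p$ and $q$ does not meet $\operatorname{int}K$, and the greatcircle through $p$ and $q$ meets $\operatorname{int}K$. The illumination number $I_{\mathbb S^d}(K)$ is the smallest cardinality of a set $S\subset\mathbb S^d\setminus K$ that lies on a $(d-1)$-dimensional greatsphere disjoint from $K$ and is such that every boundary point of $K$ is illuminated from some point of $S$. A face of $K$ is a spherically convex set $F\subseteq K$ that contains every spherical segment of $K$ whose relative interior meets $F$; its dimension is the dimension of the smallest greatsphere containing it. A partial flag of $K$ of length $d-2$ is a sequence of faces $F_2\subset F_3\subset\dots\subset F_{d-1}$ of $K$ with $\dim F_i=i$. A point $p$ of $K$ is exposed if $K\cap H=\{p\}$ for some $(d-1)$-dimensional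 greatsphere $H$ bounding a closed hemisphere that contains $K$. Then for every convex body $K$ in $\mathbb S^d$ and every $\varepsilon>0$ there is a convex body $K'\subset K$ with $I_{\mathbb S^d}(K')=d+1$ such that $K\setminus K'$ is contained in a spherical cap of radius $\varepsilon$. Moreover, $K'$ can be chosen to be a truncation of $K$ near an exposed point: there are an exposed point $p$ of $K$ with $p\notin K'$ and finitely many closed hemispheres such that $K'$ is the intersection of $K$ with these hemispheres, $K\setminus K'$ is contained in the open spherical cap of angular radius $\varepsilon$ centred at $p$, and $K'$ has a partial flag of length $d-2$ all of whose faces are contained in the boundary of $K'$ and in the bounding greatsphere of one of these hemispheres. -/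

import Mathlib

open scoped RealInnerProductSpace

noncomputable section

namespace SphericalIllumination

/-- The spherical space `S^d`: the unit sphere of the Euclidean space of dimension `d + 1`.
Interiors and frontiers of subsets of `Sph d` are taken in the topology of the sphere. -/
abbrev Sph (d : ℕ) : Type := Metric.sphere (0 : EuclideanSpace ℝ (Fin (d + 1))) 1

variable {d : ℕ}

/-- The open hemisphere with centre `n`. -/
def openHemisphere (n : Sph d) : Set (Sph d) :=
  {x | 0 < ⟪n.1, x.1⟫}

/-- The closed hemisphere with centre `n`. -/
def closedHemisphere (n : Sph d) : Set (Sph d) :=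
  {x | 0 ≤ ⟪n.1, x.1⟫}

/-- The `(d-1)`-dimensional greatsphere of `S^d` orthogonal to `n`. -/
def greatSphere (n : Sph d) : Set (Sph d) :=
  {x | ⟪n.1, x.1⟫ = 0}

/-- The open spherical cap with centre `c` and angular radius `r`. -/
def openCap (c : Sph d) (r : ℝ) : Set (Sph d) :=
  {x | InnerProductGeometry.angle c.1 x.1 < r}

/-- The spherical segment with endpoints `x` and `y`, i.e. the shorter great-circle arc
connecting them (for `y ≠ -x`): the points of the sphere in the cone spanned by `x` and `y`. -/
def sphSegment (x y : Sph d) : Set (Sph d) :=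
  {z | ∃ a b : ℝ, 0 ≤ a ∧ 0 ≤ b ∧ z.1 = a • x.1 + b • y.1}

/-- The relative interior of the spherical segment with endpoints `x` and `y` (for `y ≠ -x`). -/
def openSphSegment (x y : Sph d) : Set (Sph d) :=
  {z | ∃ a b : ℝ, 0 < a ∧ 0 < b ∧ z.1 = a • x.1 + b • y.1}

/-- The greatcircle through `x` and `y` (for `y ≠ x` and `y ≠ -x`). -/
def greatCircle (x y : Sph d) : Set (Sph d) :=
  {z | ∃ a b : ℝ, z.1 = a • x.1 + b • y.1}

/-- Spherically convex: contained in an open hemisphere and closed under spherical segments. -/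
def IsSphConvex (C : Set (Sph d)) : Prop :=
  (∃ n : Sph d, C ⊆ openHemisphere n) ∧ ∀ x ∈ C, ∀ y ∈ C, sphSegment x y ⊆ C

/-- Convex body in `S^d`: a compact spherically convex set with nonempty interior. -/
def IsConvexBody (K : Set (Sph d)) : Prop :=
  IsCompact K ∧ IsSphConvex K ∧ (interior K).Nonempty

/-- The boundary point `q` of `K` is illuminated from the point `p` outside `K`. -/
def IsIlluminatedFrom (K : Set (Sph d)) (q p : Sph d) : Prop :=
  q ∈ frontier K ∧ p ∉ K ∧ q ≠ -p ∧
    sphSegment p q ∩ interior K = ∅ ∧ (greatCircle p q ∩ interior K).Nonempty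

/-- `K` is illuminated from the set `S ⊆ S^d \ K`. -/
def IsIlluminatedBy (K S : Set (Sph d)) : Prop :=
  S ⊆ Kᶜ ∧ ∀ q ∈ frontier K, ∃ p ∈ S, IsIlluminatedFrom K q p

/-- The illumination number of `K` in `S^d`: the smallest cardinality of a set that illuminates
`K` and lies on a `(d-1)`-dimensional greatsphere disjoint from `K`. -/
def illuminationNumber (K : Set (Sph d)) : ℕ∞ :=
  sInf {k | ∃ (S : Set (Sph d)) (n : Sph d),
    S ⊆ greatSphere n ∧ Disjoint (greatSphere n) K ∧ IsIlluminatedBy K S ∧ S.encard = k}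

/-- `p` is an exposed point of `K`: some supporting greatsphere of `K` meets `K` exactly in `p`. -/
def IsExposedPoint (K : Set (Sph d)) (p : Sph d) : Prop :=
  ∃ n : Sph d, K ⊆ closedHemisphere n ∧ K ∩ greatSphere n = {p}

/-- `F` is a face of the convex body `K`. -/
def IsFace (K F : Set (Sph d)) : Prop :=
  F ⊆ K ∧ IsSphConvex F ∧
    ∀ x ∈ K, ∀ y ∈ K, (openSphSegment x y ∩ F).Nonempty → sphSegment x y ⊆ F

/-- The spherical dimension of `F` is `i`: the smallest greatsphere containing `F`, which is the
unit sphere of the linear span of `F`, has dimension `i`. -/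
def HasSphDim (F : Set (Sph d)) (i : ℕ) : Prop :=
  Module.finrank ℝ (Submodule.span ℝ ((fun x : Sph d => x.1) '' F)) = i + 1

/-- `F s ⊂ ⋯ ⊂ F (d-1)` is a partial flag of `K ⊆ S^d` of length `d - s`: a chain of faces with
`dim (F i) = i`. -/
def IsPartialFlag (K : Set (Sph d)) (s : ℕ) (F : ℕ → Set (Sph d)) : Prop :=
  (∀ i, s ≤ i → i < d → IsFace K (F i) ∧ HasSphDim (F i) i) ∧
    ∀ i, s ≤ i → i + 1 < d → F i ⊂ F (i + 1)

end SphericalIllumination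

end

open SphericalIllumination

open SphericalIllumination

namespace SphericalIllumination

open scoped RealInnerProductSpace
open Filter Topology Module

variable {d : ℕ}

/-! Replacing `K` by the cone over it turns spherical convexity into linear algebra: a boundary
point `q` is illuminated from `p` as soon as `q - s p` is interior to the cone for some `s > 0`.

At least `d + 1` sources are always needed. For at most `d` sources in the hyperplane orthogonal to
`n`, some nonzero `w` in that hyperplane has nonnegative product with each of them
(`exists_ne_zero_inner_nonneg`). A point of `K` minimising `⟪w, x⟫ / ⟪n, x⟫` has a supporting
functional that forbids its illumination from every source.

For the upper bound, `K` is intersected with a simplicial cone with generators `e 0, …, e d`, where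
all but `e 0` are interior to the cone over `K`. The facet opposite `e 0` is then a simplex inside
the interior of `K`; its faces form the flag. The body is illuminated almost like a simplex, from `d
+ 1` sources (`illuminationNumber_truncation`): the part of the boundary inherited from `K` is
served by the source that pushes away from `e 0`.

The truncation is small because the facet cuts `K` near an exposed point `p`, while `e 0` is pushed
so far that the other facets remove only points near the cut (`exists_basis_height_lt`). -/

/-- The cone of nonnegative multiples of the points of `K`. -/
def coneOver (K : Set (Sph d)) : Set (EuclideanSpace ℝ (Fin (d + 1))) :=
  {x | ∃ c : ℝ, 0 ≤ c ∧ ∃ k ∈ K, x = c • k.1}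

/-! ### Cones over spherical sets -/

lemma norm_coe_sph (x : Sph d) : ‖x.1‖ = 1 := by
  simp

lemma coe_sph_ne_zero (x : Sph d) : x.1 ≠ 0 := by
  intro h
  have := norm_coe_sph x
  simp [h] at this

lemma inner_coe_self (x : Sph d) : ⟪x.1, x.1⟫ = 1 := by
  rw [real_inner_self_eq_norm_sq, norm_coe_sph, one_pow]

/-- The radial projection of a nonzero vector to the sphere. -/
noncomputable def toSph (x : EuclideanSpace ℝ (Fin (d + 1))) (hx : x ≠ 0) : Sph d :=
  ⟨‖x‖⁻¹ • x, by simp [norm_smul, hx]⟩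

lemma coe_toSph (x : EuclideanSpace ℝ (Fin (d + 1))) (hx : x ≠ 0) :
    (toSph x hx).1 = ‖x‖⁻¹ • x := rfl

lemma coe_mem_coneOver {K : Set (Sph d)} {x : Sph d} : x.1 ∈ coneOver K ↔ x ∈ K := by
  constructor
  · rintro ⟨c, hc, k, hk, h⟩
    have h1 := congrArg norm h
    rw [norm_smul, norm_coe_sph, norm_coe_sph, mul_one, Real.norm_of_nonneg hc] at h1
    rw [← h1, one_smul] at h
    rwa [Subtype.ext h]
  · intro h
    exact ⟨1, zero_le_one, x, h, (one_smul _ _).symm⟩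

lemma smul_mem_coneOver {K : Set (Sph d)} {c : ℝ} (hc : 0 ≤ c)
    {x : EuclideanSpace ℝ (Fin (d + 1))} (hx : x ∈ coneOver K) : c • x ∈ coneOver K := by
  obtain ⟨b, hb, k, hk, rfl⟩ := hx
  exact ⟨c * b, mul_nonneg hc hb, k, hk, by rw [smul_smul]⟩

lemma zero_mem_coneOver {K : Set (Sph d)} (hK : K.Nonempty) : (0 : _) ∈ coneOver K := by
  obtain ⟨k, hk⟩ := hK
  exact ⟨0, le_rfl, k, hk, (zero_smul _ _).symm⟩

lemma toSph_mem_iff {K : Set (Sph d)} {x : EuclideanSpace ℝ (Fin (d + 1))} (hx : x ≠ 0) :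
    toSph x hx ∈ K ↔ x ∈ coneOver K := by
  rw [← coe_mem_coneOver, coe_toSph]
  refine ⟨fun h => ?_, smul_mem_coneOver (by positivity)⟩
  have := smul_mem_coneOver (norm_nonneg x) h
  rwa [smul_smul, mul_inv_cancel₀ (norm_ne_zero_iff.2 hx), one_smul] at this

lemma add_mem_coneOver {K : Set (Sph d)} (hK : IsSphConvex K)
    {x y : EuclideanSpace ℝ (Fin (d + 1))} (hx : x ∈ coneOver K) (hy : y ∈ coneOver K) :
    x + y ∈ coneOver K := by
  obtain ⟨a, ha, k, hk, rfl⟩ := hx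
  obtain ⟨b, hb, l, hl, rfl⟩ := hy
  by_cases h : a • k.1 + b • l.1 = 0
  · rw [h]; exact zero_mem_coneOver ⟨k, hk⟩
  · rw [← toSph_mem_iff h]
    refine hK.2 k hk l hl ⟨‖a • k.1 + b • l.1‖⁻¹ * a, ‖a • k.1 + b • l.1‖⁻¹ * b,
      by positivity, by positivity, ?_⟩
    rw [coe_toSph, smul_add, smul_smul, smul_smul]

lemma sum_mem_coneOver {K : Set (Sph d)} (hK : IsSphConvex K) (hne : K.Nonempty) {ι : Type*}
    (s : Finset ι) {f : ι → EuclideanSpace ℝ (Fin (d + 1))} (hf : ∀ i ∈ s, f i ∈ coneOver K) :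
    ∑ i ∈ s, f i ∈ coneOver K :=
  Finset.sum_induction f (· ∈ coneOver K) (fun _ _ => add_mem_coneOver hK)
    (zero_mem_coneOver hne) hf

lemma add_mem_interior_coneOver {K : Set (Sph d)} (hK : IsSphConvex K)
    {x y : EuclideanSpace ℝ (Fin (d + 1))} (hx : x ∈ coneOver K)
    (hy : y ∈ interior (coneOver K)) : x + y ∈ interior (coneOver K) := by
  have : (fun z => x + z) '' interior (coneOver K) ⊆ interior (coneOver K) := by
    refine interior_maximal ?_ ((Homeomorph.addLeft x).isOpenMap _ isOpen_interior)
    rintro _ ⟨z, hz, rfl⟩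
    exact add_mem_coneOver hK hx (interior_subset hz)
  exact this ⟨y, hy, rfl⟩

lemma smul_mem_interior_coneOver {K : Set (Sph d)} {c : ℝ} (hc : 0 < c)
    {x : EuclideanSpace ℝ (Fin (d + 1))} (hx : x ∈ interior (coneOver K)) :
    c • x ∈ interior (coneOver K) := by
  have : (fun z => c • z) '' interior (coneOver K) ⊆ interior (coneOver K) := by
    refine interior_maximal ?_ ((Homeomorph.smulOfNeZero c hc.ne').isOpenMap _ isOpen_interior)
    rintro _ ⟨z, hz, rfl⟩
    exact smul_mem_coneOver hc.le (interior_subset hz)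
  exact this ⟨x, hx, rfl⟩

/-- Radial projection is continuous away from the origin, so relative interiors on the sphere
correspond to linear interiors of cones. -/
lemma coe_mem_interior_coneOver {K : Set (Sph d)} {x : Sph d} :
    x.1 ∈ interior (coneOver K) ↔ x ∈ interior K := by
  constructor
  · intro h
    have hsub : (fun y : Sph d => y.1) ⁻¹' interior (coneOver K) ⊆ K := fun y hy =>
      coe_mem_coneOver.1 (interior_subset hy)
    exact interior_maximal hsub (isOpen_interior.preimage continuous_subtype_val) h
  · intro h
    rw [mem_interior_iff_mem_nhds, mem_nhds_subtype] at h
    obtain ⟨u, hu, huK⟩ := h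
    rw [mem_interior_iff_mem_nhds]
    have hc : ContinuousAt (fun y : EuclideanSpace ℝ (Fin (d + 1)) => ‖y‖⁻¹ • y) x.1 :=
      (continuous_norm.continuousAt.inv₀ (norm_ne_zero_iff.2 (coe_sph_ne_zero x))).smul
        continuousAt_id
    have hx : ‖x.1‖⁻¹ • x.1 = x.1 := by rw [norm_coe_sph, inv_one, one_smul]
    have hu' : u ∈ 𝓝 (‖x.1‖⁻¹ • x.1) := by rwa [hx]
    filter_upwards [hc.preimage_mem_nhds hu', isOpen_ne.mem_nhds (coe_sph_ne_zero x)] with y hy hy0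
    rw [← toSph_mem_iff hy0]
    exact huK hy

lemma toSph_mem_interior {K : Set (Sph d)} {x : EuclideanSpace ℝ (Fin (d + 1))} (hx : x ≠ 0)
    (h : x ∈ interior (coneOver K)) : toSph x hx ∈ interior K := by
  rw [← coe_mem_interior_coneOver, coe_toSph]
  exact smul_mem_interior_coneOver (by positivity) h

/-- A nonzero linear functional that is nonnegative on a set is positive on its interior. -/
lemma pos_of_mem_interior {E : Type*} [NormedAddCommGroup E] [NormedSpace ℝ E] {C : Set E}
    {f : E →ₗ[ℝ] ℝ} (hf : f ≠ 0) (h : ∀ x ∈ C, 0 ≤ f x) {z : E} (hz : z ∈ interior C) :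
    0 < f z := by
  obtain ⟨y, hy⟩ : ∃ y, f y ≠ 0 := by
    by_contra! H
    exact hf (LinearMap.ext H)
  have hc : Tendsto (fun s : ℝ => z - s • (f y • y)) (𝓝[>] 0) (𝓝 z) := by
    have : Continuous (fun s : ℝ => z - s • (f y • y)) := by fun_prop
    simpa using (this.tendsto 0).mono_left nhdsWithin_le_nhds
  obtain ⟨s, hs, hs0⟩ := ((hc.eventually (isOpen_interior.mem_nhds hz)).and
    self_mem_nhdsWithin).exists
  have h1 := h _ (interior_subset hs)
  simp only [map_sub, map_smul, smul_eq_mul] at h1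
  have : 0 < s * (f y * f y) := mul_pos hs0 (mul_self_pos.2 hy)
  linarith

lemma nonneg_on_coneOver {K : Set (Sph d)} {f : EuclideanSpace ℝ (Fin (d + 1)) →ₗ[ℝ] ℝ}
    (h : ∀ x ∈ K, 0 ≤ f x.1) : ∀ x ∈ coneOver K, 0 ≤ f x := by
  rintro _ ⟨c, hc, k, hk, rfl⟩
  rw [map_smul]
  exact mul_nonneg hc (h k hk)

/-- A nonzero linear functional is a positive multiple of the inner product with a unit vector. -/
lemma exists_sph_inner_eq (f : EuclideanSpace ℝ (Fin (d + 1)) →ₗ[ℝ] ℝ) (hf : f ≠ 0) :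
    ∃ n : Sph d, ∃ c : ℝ, 0 < c ∧ ∀ x, ⟪n.1, x⟫ = c * f x := by
  set g := (InnerProductSpace.toDual ℝ (EuclideanSpace ℝ (Fin (d + 1)))).symm
    (LinearMap.toContinuousLinearMap f) with hg
  have hgx : ∀ x, ⟪g, x⟫ = f x := fun x => by
    rw [hg, InnerProductSpace.toDual_symm_apply]; rfl
  have hg0 : g ≠ 0 := by
    intro h
    refine hf (LinearMap.ext fun x => ?_)
    rw [← hgx, h, inner_zero_left]; rfl
  refine ⟨toSph g hg0, ‖g‖⁻¹, by positivity, fun x => ?_⟩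
  rw [coe_toSph, real_inner_smul_left, hgx]

lemma frontier_eq_diff {K : Set (Sph d)} (hK : IsCompact K) : frontier K = K \ interior K :=
  hK.isClosed.frontier_eq

/-! ### Illumination in terms of cones -/

/-- An interior point `z = a p + b q` on the segment would make `a (q - s p) + s z` interior. This
is a positive multiple of `q`, which is a boundary point. -/
lemma isIlluminatedFrom_of_sub_smul_mem {K : Set (Sph d)} (hK : IsSphConvex K) {n q p : Sph d}
    (hn : ∀ x ∈ K, 0 < ⟪n.1, x.1⟫) (hq : q ∈ frontier K) (hqK : q ∈ K) (hp : ⟪n.1, p.1⟫ = 0)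
    {s : ℝ} (hs : 0 < s) (h : q.1 - s • p.1 ∈ interior (coneOver K)) :
    IsIlluminatedFrom K q p := by
  refine ⟨hq, fun hpK => (hn p hpK).ne' hp, fun h => ?_, ?_, ?_⟩
  · have := hn q hqK
    rw [h] at this
    simp [hp] at this
  · by_contra hne
    obtain ⟨z, ⟨a, b, ha, hb, hz⟩, hzK⟩ := Set.nonempty_iff_ne_empty.2 hne
    have h1 := hn z (interior_subset hzK)
    rw [hz, inner_add_right, real_inner_smul_right, real_inner_smul_right, hp, mul_zero,
      zero_add] at h1
    have hb : 0 < b := pos_of_mul_pos_left h1 (hn q hqK).le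
    have h2 := add_mem_interior_coneOver hK
      (smul_mem_coneOver ha (interior_subset h))
      (smul_mem_interior_coneOver hs (coe_mem_interior_coneOver.2 hzK))
    have h3 : a • (q.1 - s • p.1) + s • z.1 = (a + s * b) • q.1 := by rw [hz]; module
    rw [h3] at h2
    have h4 : 0 < a + s * b := by positivity
    have h5 := smul_mem_interior_coneOver (inv_pos.2 h4) h2
    rw [smul_smul, inv_mul_cancel₀ h4.ne', one_smul, coe_mem_interior_coneOver] at h5
    exact hq.2 h5
  · have h0 : q.1 - s • p.1 ≠ 0 := by
      intro h0
      have h1 := hn q hqK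
      rw [sub_eq_zero.1 h0, real_inner_smul_right, hp, mul_zero] at h1
      exact lt_irrefl _ h1
    refine ⟨toSph _ h0, ⟨-(‖q.1 - s • p.1‖⁻¹ * s), ‖q.1 - s • p.1‖⁻¹, ?_⟩,
      toSph_mem_interior h0 h⟩
    rw [coe_toSph]; module

/-- Positivity of `n` on `K` forces `b > 0` when `p` is orthogonal to `n`; with `a ≥ 0` the interior
point would lie on the forbidden segment. -/
lemma exists_neg_smul_add_of_isIlluminatedFrom {K : Set (Sph d)} {n q p : Sph d}
    (hn : ∀ x ∈ K, 0 < ⟪n.1, x.1⟫) (hqK : q ∈ K) (hp : ⟪n.1, p.1⟫ = 0)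
    (h : IsIlluminatedFrom K q p) :
    ∃ a b : ℝ, a < 0 ∧ ∃ z ∈ interior K, z.1 = a • p.1 + b • q.1 := by
  obtain ⟨-, -, -, h1, z, ⟨a, b, hz⟩, hzK⟩ := h
  refine ⟨a, b, ?_, z, hzK, hz⟩
  by_contra! ha
  have h2 := hn z (interior_subset hzK)
  rw [hz, inner_add_right, real_inner_smul_right, real_inner_smul_right, hp, mul_zero,
    zero_add] at h2
  have hb : 0 < b := pos_of_mul_pos_left h2 (hn q hqK).le
  exact (h1 ▸ (⟨⟨a, b, ha, hb.le, hz⟩, hzK⟩ : z ∈ sphSegment p q ∩ interior K) : z ∈ (∅ : Set _))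

/-! ### The lower bound -/

/-- Fewer than `d + 1` vectors orthogonal to `n` lie in a closed half-space of `nᗮ`. -/
lemma exists_ne_zero_inner_nonneg (hd : 0 < d) (n : Sph d) (S : Set (Sph d)) [Fintype S]
    (hS : Fintype.card S ≤ d) :
    ∃ w : EuclideanSpace ℝ (Fin (d + 1)), w ≠ 0 ∧ ⟪n.1, w⟫ = 0 ∧ ∀ p ∈ S, 0 ≤ ⟪p.1, w⟫ := by
  let T : EuclideanSpace ℝ (Fin (d + 1)) →ₗ[ℝ] ℝ × (S → ℝ) :=
    (innerₗ _ n.1).prod (LinearMap.pi fun p : S => innerₗ _ p.1.1)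
  have hdim : finrank ℝ (ℝ × (S → ℝ)) = 1 + Fintype.card S := by simp
  have hdimE : finrank ℝ (EuclideanSpace ℝ (Fin (d + 1))) = d + 1 := by simp
  -- An injective `T` is bijective by dimension count, so all products with `S` can be prescribed to
  -- be `1`; otherwise a kernel vector works.
  by_cases hT : Function.Injective T
  · have h1 := LinearMap.finrank_le_finrank_of_injective hT
    have h2 : finrank ℝ (EuclideanSpace ℝ (Fin (d + 1))) = finrank ℝ (ℝ × (S → ℝ)) := by omega
    obtain ⟨w, hw⟩ := (LinearMap.injective_iff_surjective_of_finrank_eq_finrank h2).1 hT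
      (0, fun _ => 1)
    have hw1 : ∀ p (hp : p ∈ S), ⟪p.1, w⟫ = 1 := fun p hp => congrFun (congrArg Prod.snd hw) ⟨p, hp⟩
    refine ⟨w, ?_, congrArg Prod.fst hw, fun p hp => by rw [hw1 p hp]; exact zero_le_one⟩
    rintro rfl
    have : 0 < Fintype.card S := by omega
    obtain ⟨p, hp⟩ := Fintype.card_pos_iff.1 this
    simpa using hw1 p hp
  · rw [← LinearMap.ker_eq_bot, Submodule.eq_bot_iff] at hT
    push Not at hT
    obtain ⟨w, hw, hw0⟩ := hT
    have hw' : T w = 0 := hw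
    exact ⟨w, hw0, congrArg Prod.fst hw',
      fun p hp => (congrFun (congrArg Prod.snd hw') ⟨p, hp⟩).ge⟩

/-- An arc between points on opposite sides would cross the greatsphere inside `K`; the crossing
vector is nonzero because `K` lies in an open hemisphere. -/
lemma inner_pos_or_neg_of_disjoint {K : Set (Sph d)} (hK : IsSphConvex K) {n : Sph d}
    (h : Disjoint (greatSphere n) K) :
    (∀ x ∈ K, 0 < ⟪n.1, x.1⟫) ∨ ∀ x ∈ K, 0 < ⟪(-n).1, x.1⟫ := by
  have hne : ∀ x ∈ K, ⟪n.1, x.1⟫ ≠ 0 := fun x hx h0 => Set.disjoint_left.1 h h0 hx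
  by_contra! H
  obtain ⟨⟨x, hx, hx0⟩, y, hy, hy0⟩ := H
  have hx1 := lt_of_le_of_ne hx0 (hne x hx)
  have hy1 : 0 < ⟪n.1, y.1⟫ := by
    refine lt_of_le_of_ne ?_ (hne y hy).symm
    simpa using hy0
  have hz := add_mem_coneOver hK (smul_mem_coneOver hy1.le (coe_mem_coneOver.2 hx))
    (smul_mem_coneOver (neg_nonneg.2 hx1.le) (coe_mem_coneOver.2 hy))
  obtain ⟨m, hm⟩ := hK.1
  have hz0 : ⟪n.1, y.1⟫ • x.1 + (-⟪n.1, x.1⟫) • y.1 ≠ 0 := by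
    intro h0
    have h1 := congrArg (fun v => ⟪m.1, v⟫) h0
    simp only [inner_add_right, real_inner_smul_right, inner_zero_right] at h1
    have h2 : 0 < ⟪m.1, x.1⟫ := hm hx
    have h3 : 0 < ⟪m.1, y.1⟫ := hm hy
    have := mul_pos hy1 h2
    have := mul_pos (neg_pos.2 hx1) h3
    linarith
  refine hne _ ((toSph_mem_iff hz0).2 hz) ?_
  rw [coe_toSph, real_inner_smul_right, inner_add_right, real_inner_smul_right,
    real_inner_smul_right]
  ring

/-- A convex body cannot be illuminated from fewer than `d + 1` points of a disjoint
greatsphere. -/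
lemma lt_encard_of_isIlluminatedBy (hd : 0 < d) {K S : Set (Sph d)} (hK : IsConvexBody K)
    {n : Sph d} (hn : ∀ x ∈ K, 0 < ⟪n.1, x.1⟫) (hSn : S ⊆ greatSphere n)
    (h : IsIlluminatedBy K S) : (d : ℕ∞) < S.encard := by
  by_contra! hlt
  have hfin : S.Finite := Set.finite_of_encard_le_coe hlt
  have := hfin.fintype
  rw [Set.encard_eq_coe_toFinset_card, Nat.cast_le, Set.toFinset_card] at hlt
  obtain ⟨w, hw0, hnw, hw⟩ := exists_ne_zero_inner_nonneg hd n S hlt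
  -- In the central projection from `n` this quotient is an affine function; its minimum `μ` makes
  -- `w - μ n` a supporting functional at `q`.
  have hcont : ContinuousOn (fun x : Sph d => ⟪w, x.1⟫ / ⟪n.1, x.1⟫) K := by
    refine ContinuousOn.div (by fun_prop) (by fun_prop) fun x hx => (hn x hx).ne'
  obtain ⟨q, hqK, hq⟩ := hK.1.exists_isMinOn (hK.2.2.mono interior_subset) hcont
  set μ := ⟪w, q.1⟫ / ⟪n.1, q.1⟫ with hμ
  let f : EuclideanSpace ℝ (Fin (d + 1)) →ₗ[ℝ] ℝ := innerₗ _ (w - μ • n.1)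
  have hfx : ∀ x, f x = ⟪w, x⟫ - μ * ⟪n.1, x⟫ := fun x => by
    simp [f]
  have hf0 : f ≠ 0 := by
    intro hf
    have h1 := hfx w
    rw [hf, hnw, real_inner_self_eq_norm_sq, LinearMap.zero_apply, mul_zero, sub_zero] at h1
    exact hw0 (norm_eq_zero.1 (pow_eq_zero_iff two_ne_zero |>.1 h1.symm))
  have hfK : ∀ x ∈ K, 0 ≤ f x.1 := fun x hx => by
    have h1 : μ ≤ ⟪w, x.1⟫ / ⟪n.1, x.1⟫ := hq hx
    rw [le_div_iff₀ (hn x hx)] at h1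
    rw [hfx]; linarith
  have hfpos : ∀ z ∈ interior K, 0 < f z.1 := fun z hz =>
    pos_of_mem_interior hf0 (nonneg_on_coneOver hfK) (coe_mem_interior_coneOver.2 hz)
  have hfq : f q.1 = 0 := by
    rw [hfx, hμ, div_mul_cancel₀ _ (hn q hqK).ne', sub_self]
  have hqf : q ∈ frontier K := by
    rw [frontier_eq_diff hK.1]
    exact ⟨hqK, fun hqi => (hfpos q hqi).ne' hfq⟩
  obtain ⟨p, hpS, hp⟩ := h.2 q hqf
  have hnp : ⟪n.1, p.1⟫ = 0 := hSn hpS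
  obtain ⟨a, b, ha, z, hz, hzeq⟩ := exists_neg_smul_add_of_isIlluminatedFrom hn hqK hnp hp
  have h1 := hfpos z hz
  have h2 := hw p hpS
  rw [hzeq, map_add, map_smul, map_smul, hfq, smul_zero, add_zero, hfx, hnp, mul_zero, sub_zero,
    smul_eq_mul, real_inner_comm] at h1
  exact absurd h1 (not_lt.2 (mul_nonpos_of_nonpos_of_nonneg ha.le h2))

lemma le_illuminationNumber (hd : 0 < d) {K : Set (Sph d)} (hK : IsConvexBody K) :
    (d : ℕ∞) + 1 ≤ illuminationNumber K := by
  refine le_sInf ?_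
  rintro _ ⟨S, n, hSn, hdisj, hS, rfl⟩
  refine Order.add_one_le_of_lt ?_
  rcases inner_pos_or_neg_of_disjoint hK.2.1 hdisj with hn | hn
  · exact lt_encard_of_isIlluminatedBy hd hK hn hSn hS
  · refine lt_encard_of_isIlluminatedBy hd hK hn (fun p hp => ?_) hS
    have h1 : ⟪n.1, p.1⟫ = 0 := hSn hp
    simp [greatSphere, h1]

/-! ### Truncation by a simplicial cone -/

/-- The part of `K` in the simplicial cone spanned by the basis `e`. -/
def truncation (K : Set (Sph d)) (e : Basis (Fin (d + 1)) ℝ (EuclideanSpace ℝ (Fin (d + 1)))) :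
    Set (Sph d) :=
  {x | x ∈ K ∧ ∀ i, 0 ≤ e.coord i x.1}

section Truncation

variable {K : Set (Sph d)} {e : Basis (Fin (d + 1)) ℝ (EuclideanSpace ℝ (Fin (d + 1)))}

lemma continuous_coord (i : Fin (d + 1)) : Continuous (e.coord i) :=
  LinearMap.continuous_of_finiteDimensional _

lemma coord_ne_zero (i : Fin (d + 1)) : e.coord i ≠ 0 := by
  intro h
  have h1 := e.coord_apply i (e i)
  rw [h, Basis.repr_self, Finsupp.single_eq_same] at h1
  exact zero_ne_one h1

lemma coord_basis (i j : Fin (d + 1)) : e.coord i (e j) = if j = i then 1 else 0 := by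
  rw [Basis.coord_apply, Basis.repr_self, Finsupp.single_apply]

lemma sum_coord (x : EuclideanSpace ℝ (Fin (d + 1))) : ∑ i, e.coord i x • e i = x :=
  e.sum_repr x

lemma isSphConvex_truncation (hK : IsSphConvex K) : IsSphConvex (truncation K e) := by
  refine ⟨hK.1.imp fun n hn x hx => hn hx.1, ?_⟩
  intro x hx y hy z hz
  refine ⟨hK.2 x hx.1 y hy.1 hz, fun i => ?_⟩
  obtain ⟨a, b, ha, hb, hz⟩ := hz
  rw [hz, map_add, map_smul, map_smul]
  exact add_nonneg (mul_nonneg ha (hx.2 i)) (mul_nonneg hb (hy.2 i))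

lemma isCompact_truncation (hK : IsCompact K) : IsCompact (truncation K e) := by
  have : truncation K e = K ∩ ⋂ i, {x : Sph d | 0 ≤ e.coord i x.1} := by
    ext x; simp [truncation]
  rw [this]
  exact hK.inter_right (isClosed_iInter fun i =>
    isClosed_le continuous_const ((continuous_coord i).comp continuous_subtype_val))

lemma mem_coneOver_truncation {x : EuclideanSpace ℝ (Fin (d + 1))} (hx : x ≠ 0)
    (hxK : x ∈ coneOver K) (h : ∀ i, 0 ≤ e.coord i x) : x ∈ coneOver (truncation K e) := by
  rw [← toSph_mem_iff hx]
  refine ⟨(toSph_mem_iff hx).2 hxK, fun i => ?_⟩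
  rw [coe_toSph, map_smul]
  exact mul_nonneg (by positivity) (h i)

lemma mem_interior_coneOver_truncation {x : EuclideanSpace ℝ (Fin (d + 1))}
    (hxK : x ∈ interior (coneOver K)) (h : ∀ i, 0 < e.coord i x) :
    x ∈ interior (coneOver (truncation K e)) := by
  rw [mem_interior_iff_mem_nhds]
  have h1 : ∀ᶠ y in 𝓝 x, ∀ i, 0 < e.coord i y := eventually_all.2 fun i =>
    (continuous_coord i).continuousAt.eventually (lt_mem_nhds (h i))
  filter_upwards [h1, mem_interior_iff_mem_nhds.1 hxK] with y hy hyK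
  refine mem_coneOver_truncation ?_ hyK fun i => (hy i).le
  rintro rfl
  simpa using hy 0

lemma sum_smul_mem_interior (hK : IsSphConvex K) (hne : K.Nonempty)
    (he : ∀ j : Fin d, e j.succ ∈ interior (coneOver K)) {c : Fin (d + 1) → ℝ}
    (hc : ∀ i, 0 ≤ c i) (hc0 : c 0 = 0) {j : Fin (d + 1)} (hj : 0 < c j) :
    ∑ i, c i • e i ∈ interior (coneOver K) := by
  rw [← Finset.sum_erase_add _ _ (Finset.mem_univ j)]
  refine add_mem_interior_coneOver hK (sum_mem_coneOver hK hne _ fun i _ => ?_) ?_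
  · induction i using Fin.cases with
    | zero => rw [hc0, zero_smul]; exact zero_mem_coneOver hne
    | succ i => exact smul_mem_coneOver (hc _) (interior_subset (he i))
  · induction j using Fin.cases with
    | zero => exact absurd hc0 hj.ne'
    | succ j => exact smul_mem_interior_coneOver hj (he j)

/-- The weights `(δ, 1, …, 1)`. -/
def weight (δ : ℝ) (i : Fin (d + 1)) : ℝ := if i = 0 then δ else 1

lemma weight_pos {δ : ℝ} (hδ : 0 < δ) (i : Fin (d + 1)) : 0 < weight δ i := by
  unfold weight; split_ifs <;> simp [hδ]

/-- At `δ = 0` both vectors are the sum of the `e j.succ`, which is interior, so small positive `δ`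
work. The first vector gives an interior point of the truncation, the second an illuminating
direction. -/
lemma exists_sum_weight_mem_interior (hd : 0 < d) (hK : IsSphConvex K) (hne : K.Nonempty)
    (he : ∀ j : Fin d, e j.succ ∈ interior (coneOver K)) :
    ∃ δ : ℝ, 0 < δ ∧ ∑ i, weight δ i • e i ∈ interior (coneOver K) ∧
      ∑ i, weight δ i • e i - ((d + 1) * δ) • e 0 ∈ interior (coneOver K) := by
  have h0 : ∑ i, weight 0 i • e i ∈ interior (coneOver K) := by
    refine sum_smul_mem_interior hK hne he (fun i => ?_) (if_pos rfl) (j := (⟨0, hd⟩ : Fin d).succ)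
      ?_
    · unfold weight; split_ifs <;> simp
    · simp [weight]
  have hw : ∀ i : Fin (d + 1), Continuous fun δ : ℝ => weight δ i := fun i => by
    by_cases hi : i = 0 <;> simp only [weight, hi, if_true, if_false] <;> fun_prop
  have h1 : Continuous fun δ : ℝ => ∑ i, weight δ i • e i :=
    continuous_finsetSum _ fun i _ => (hw i).smul continuous_const
  have h2 : Continuous fun δ : ℝ => ∑ i, weight δ i • e i - ((d + 1) * δ) • e 0 :=
    h1.sub (by fun_prop)
  have e1 : ∀ᶠ δ : ℝ in 𝓝[>] 0, ∑ i, weight δ i • e i ∈ interior (coneOver K) :=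
    nhdsWithin_le_nhds (h1.continuousAt.eventually (isOpen_interior.mem_nhds h0))
  have e2 : ∀ᶠ δ : ℝ in 𝓝[>] 0,
      ∑ i, weight δ i • e i - ((d + 1) * δ) • e 0 ∈ interior (coneOver K) :=
    nhdsWithin_le_nhds (h2.continuousAt.eventually (isOpen_interior.mem_nhds (by simpa using h0)))
  obtain ⟨δ, hδ, hδ1, hδ2⟩ := (eventually_mem_nhdsWithin.and (e1.and e2)).exists
  exact ⟨δ, hδ, hδ1, hδ2⟩

lemma isConvexBody_truncation (hd : 0 < d) (hK : IsConvexBody K)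
    (he : ∀ j : Fin d, e j.succ ∈ interior (coneOver K)) : IsConvexBody (truncation K e) := by
  refine ⟨isCompact_truncation hK.1, isSphConvex_truncation hK.2.1, ?_⟩
  obtain ⟨δ, hδ, h, -⟩ :=
    exists_sum_weight_mem_interior hd hK.2.1 (hK.2.2.mono interior_subset) he
  have hc : ∀ i, e.coord i (∑ i, weight δ i • e i) = weight δ i := fun i => by
    simp [Finsupp.single_apply]
  have h0 : ∑ i, weight δ i • e i ≠ 0 := by
    intro h0
    have := hc 0
    rw [h0, map_zero] at this
    exact (weight_pos hδ _).ne this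
  refine ⟨_, toSph_mem_interior h0 (mem_interior_coneOver_truncation h fun i => ?_)⟩
  rw [hc]; exact weight_pos hδ i

lemma eventually_add_smul_mem {E : Type*} [NormedAddCommGroup E] [NormedSpace ℝ E] {U : Set E}
    (hU : IsOpen U) {q : E} (hq : q ∈ U) (u : E) : ∀ᶠ s : ℝ in 𝓝[>] 0, q + s • u ∈ U := by
  have h : Continuous fun s : ℝ => q + s • u := by fun_prop
  exact nhdsWithin_le_nhds (h.continuousAt.eventually (hU.mem_nhds (by simpa using hq)))

/-! ### Illuminating the truncation from `d + 1` points -/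

lemma illuminationNumber_truncation (hd : 0 < d) (hK : IsConvexBody K)
    (he : ∀ j : Fin d, e j.succ ∈ interior (coneOver K)) :
    illuminationNumber (truncation K e) = (d : ℕ∞) + 1 := by
  have hbody := isConvexBody_truncation hd hK he
  refine le_antisymm ?_ (le_illuminationNumber hd hbody)
  have hne : K.Nonempty := hK.2.2.mono interior_subset
  obtain ⟨δ, hδ, -, hδK⟩ := exists_sum_weight_mem_interior hd hK.2.1 hne he
  set κ : Fin (d + 1) → ℝ := weight δ with hκ
  have hκ0 : ∀ i, 0 < κ i := weight_pos hδ
  let f : EuclideanSpace ℝ (Fin (d + 1)) →ₗ[ℝ] ℝ := ∑ i, (κ i)⁻¹ • e.coord i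
  have hf : ∀ x, f x = ∑ i, (κ i)⁻¹ * e.coord i x := fun x => by simp [f]
  have hf0 : f ≠ 0 := by
    intro h
    have h1 := hf (e 0)
    simp [h, Finsupp.single_apply] at h1
    exact (hκ0 0).ne h1
  obtain ⟨n, c, hc, hn⟩ := exists_sph_inner_eq f hf0
  have hnpos : ∀ x ∈ truncation K e, 0 < ⟪n.1, x.1⟫ := by
    intro x hx
    rw [hn, hf]
    refine mul_pos hc ?_
    have hnn : ∀ i ∈ Finset.univ, 0 ≤ (κ i)⁻¹ * e.coord i x.1 := fun i _ =>
      mul_nonneg (inv_pos.2 (hκ0 i)).le (hx.2 i)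
    refine (Finset.sum_nonneg hnn).lt_of_ne fun h => coe_sph_ne_zero x ?_
    rw [eq_comm, Finset.sum_eq_zero_iff_of_nonneg hnn] at h
    rw [← sum_coord (e := e) x.1]
    refine Finset.sum_eq_zero fun i hi => ?_
    rw [(mul_eq_zero.1 (h i hi)).resolve_left (inv_pos.2 (hκ0 i)).ne', zero_smul]
  -- Moving along `u i` increases every coordinate except the `i`-th. The factor `d + 1` makes `f (u
  -- i) = 0`, so the sources lie on one greatsphere.
  let u : Fin (d + 1) → EuclideanSpace ℝ (Fin (d + 1)) := fun i =>
    ∑ k, κ k • e k - ((d + 1) * κ i) • e i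
  have hu : ∀ i k, e.coord k (u i) = κ k - if i = k then (d + 1) * κ i else 0 := fun i k => by
    simp only [u, map_sub, map_sum, map_smul, coord_basis, smul_eq_mul]
    simp
  have hu0 : ∀ i, u i ≠ 0 := by
    intro i h
    have h1 := hu i i
    rw [h, map_zero, if_pos rfl] at h1
    have h2 : 0 < (d : ℝ) * κ i := mul_pos (Nat.cast_pos.2 hd) (hκ0 i)
    linarith
  have hfu : ∀ i, f (u i) = 0 := by
    intro i
    have h1 : ∀ k, (κ k)⁻¹ * e.coord k (u i) = 1 - if i = k then (d + 1 : ℝ) else 0 := by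
      intro k
      rw [hu]
      have := (hκ0 k).ne'
      split_ifs with hik
      · subst hik; field_simp
      · simp [this]
    rw [hf, Finset.sum_congr rfl fun k _ => h1 k, Finset.sum_sub_distrib]
    simp
  have hnu0 : ∀ i, -u i ≠ 0 := fun i => neg_ne_zero.2 (hu0 i)
  let p : Fin (d + 1) → Sph d := fun i => toSph (-u i) (hnu0 i)
  have hp : ∀ i, ⟪n.1, (p i).1⟫ = 0 := fun i => by
    simp only [p, coe_toSph, hn, map_smul, map_neg, hfu]; simp
  have hill : IsIlluminatedBy (truncation K e) (Set.range p) := by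
    constructor
    · rintro x ⟨i, rfl⟩ h
      exact (hnpos _ h).ne' (hp i)
    · intro q hq
      have hqK : q ∈ truncation K e := hbody.1.isClosed.frontier_subset hq
      obtain ⟨i, hi, hev⟩ : ∃ i, 0 < e.coord i q.1 ∧
          ∀ᶠ s : ℝ in 𝓝[>] 0, q.1 + s • u i ∈ interior (coneOver K) := by
        -- If the `0`-th coordinate is positive, `u 0` points into the cone over `K`, even from its
        -- boundary. If it vanishes, `q` is already interior to `K`, and any `i` with positive
        -- coordinate serves.
        rcases (hqK.2 0).lt_or_eq with h0 | h0
        · refine ⟨0, h0, ?_⟩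
          have hu00 : u 0 ∈ interior (coneOver K) := by
            have : κ 0 = δ := if_pos rfl
            simpa [u, this] using hδK
          filter_upwards [self_mem_nhdsWithin] with s hs
          exact add_mem_interior_coneOver hK.2.1 (coe_mem_coneOver.2 hqK.1)
            (smul_mem_interior_coneOver hs hu00)
        · obtain ⟨i, hi⟩ : ∃ i, 0 < e.coord i q.1 := by
            by_contra! H
            refine coe_sph_ne_zero q ?_
            rw [← sum_coord (e := e) q.1]
            refine Finset.sum_eq_zero fun i _ => ?_
            rw [le_antisymm (H i) (hqK.2 i), zero_smul]
          refine ⟨i, hi, eventually_add_smul_mem isOpen_interior ?_ _⟩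
          have := sum_smul_mem_interior hK.2.1 hne he hqK.2 h0.symm hi
          rwa [sum_coord] at this
      have hev2 : ∀ᶠ s : ℝ in 𝓝[>] 0, 0 < e.coord i (q.1 + s • u i) :=
        eventually_add_smul_mem (isOpen_lt continuous_const (continuous_coord i)) hi (u i)
      obtain ⟨s, hs, hs1, hs2⟩ := (eventually_mem_nhdsWithin.and (hev.and hev2)).exists
      have hs0 : (0 : ℝ) < s := hs
      have hun : 0 < ‖-u i‖ := norm_pos_iff.2 (hnu0 i)
      refine ⟨p i, ⟨i, rfl⟩, isIlluminatedFrom_of_sub_smul_mem hbody.2.1 hnpos hq hqK (hp i)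
        (mul_pos hs0 hun) ?_⟩
      have heq : q.1 - (s * ‖-u i‖) • (p i).1 = q.1 + s • u i := by
        rw [coe_toSph, smul_smul, mul_assoc, mul_inv_cancel₀ hun.ne', mul_one, smul_neg,
          sub_neg_eq_add]
      rw [heq]
      refine mem_interior_coneOver_truncation hs1 fun k => ?_
      by_cases hik : i = k
      · subst hik; exact hs2
      · rw [map_add, map_smul, hu, if_neg hik, sub_zero]
        exact add_pos_of_nonneg_of_pos (hqK.2 k) (mul_pos hs0 (hκ0 k))
  have hmem : (Set.range p).encard ∈ {k | ∃ (S : Set (Sph d)) (n : Sph d), S ⊆ greatSphere n ∧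
      Disjoint (greatSphere n) (truncation K e) ∧ IsIlluminatedBy (truncation K e) S ∧
      S.encard = k} := by
    refine ⟨Set.range p, n, ?_, ?_, hill, rfl⟩
    · rintro x ⟨i, rfl⟩; exact hp i
    · exact Set.disjoint_left.2 fun x hx hxK => (hnpos x hxK).ne' hx
  refine (sInf_le hmem).trans ?_
  rw [← Set.image_univ]
  refine (Set.encard_image_le _ _).trans ?_
  simp

/-! ### The flag in the facet opposite `e 0` -/

/-- The face of the truncation spanned by `e 1, …, e (i + 1)`. -/
def truncationFace (K : Set (Sph d))
    (e : Basis (Fin (d + 1)) ℝ (EuclideanSpace ℝ (Fin (d + 1)))) (i : ℕ) : Set (Sph d) :=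
  {x | x ∈ truncation K e ∧ ∀ j : Fin (d + 1), (j = 0 ∨ i + 1 < (j : ℕ)) → e.coord j x.1 = 0}

/-- All coordinates are nonnegative on the truncation, so one that vanishes inside a segment
vanishes at both ends. -/
lemma isFace_truncationFace (hK : IsSphConvex K) (i : ℕ) :
    IsFace (truncation K e) (truncationFace K e i) := by
  have hT := isSphConvex_truncation (e := e) hK
  have hseg : ∀ x ∈ truncationFace K e i, ∀ y ∈ truncationFace K e i,
      sphSegment x y ⊆ truncationFace K e i := by
    intro x hx y hy z hz
    refine ⟨hT.2 x hx.1 y hy.1 hz, fun j hj => ?_⟩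
    obtain ⟨a, b, -, -, hz⟩ := hz
    rw [hz, map_add, map_smul, map_smul, hx.2 j hj, hy.2 j hj, smul_zero, smul_zero, add_zero]
  refine ⟨fun x hx => hx.1, ⟨hT.1.imp fun n hn x hx => hn hx.1, hseg⟩, ?_⟩
  rintro x hx y hy ⟨z, ⟨a, b, ha, hb, hz⟩, hzF⟩
  have key : ∀ j : Fin (d + 1), (j = 0 ∨ i + 1 < (j : ℕ)) →
      e.coord j x.1 = 0 ∧ e.coord j y.1 = 0 := by
    intro j hj
    have h := hzF.2 j hj
    rw [hz, map_add, map_smul, map_smul, smul_eq_mul, smul_eq_mul,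
      add_eq_zero_iff_of_nonneg (mul_nonneg ha.le (hx.2 j)) (mul_nonneg hb.le (hy.2 j))] at h
    exact ⟨(mul_eq_zero.1 h.1).resolve_left ha.ne', (mul_eq_zero.1 h.2).resolve_left hb.ne'⟩
  exact hseg x ⟨hx, fun j hj => (key j hj).1⟩ y ⟨hy, fun j hj => (key j hj).2⟩

lemma toSph_basis_mem_truncationFace (he : ∀ j : Fin d, e j.succ ∈ interior (coneOver K))
    {i : ℕ} (j : Fin d) (hj : (j : ℕ) ≤ i) :
    toSph (e j.succ) (e.ne_zero _) ∈ truncationFace K e i := by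
  refine ⟨⟨(toSph_mem_iff _).2 (interior_subset (he j)), fun k => ?_⟩, fun k hk => ?_⟩
  · rw [coe_toSph, map_smul, coord_basis]
    refine mul_nonneg (by positivity) ?_
    split_ifs <;> simp
  · rw [coe_toSph, map_smul, coord_basis, if_neg, smul_zero]
    rintro rfl
    rcases hk with hk | hk
    · exact Fin.succ_ne_zero _ hk
    · rw [Fin.val_succ] at hk; omega

lemma hasSphDim_truncationFace (he : ∀ j : Fin d, e j.succ ∈ interior (coneOver K))
    {i : ℕ} (hi : i < d) : HasSphDim (truncationFace K e i) i := by
  let v : Fin (i + 1) → EuclideanSpace ℝ (Fin (d + 1)) := fun k =>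
    e (Fin.castLE (Nat.succ_le_of_lt hi) k).succ
  have hli : LinearIndependent ℝ v := e.linearIndependent.comp _
    ((Fin.succ_injective d).comp (Fin.castLE_injective _))
  have hspan : Submodule.span ℝ ((fun x : Sph d => x.1) '' truncationFace K e i) =
      Submodule.span ℝ (Set.range v) := by
    apply le_antisymm
    · rw [Submodule.span_le]
      rintro _ ⟨x, hx, rfl⟩
      change x.1 ∈ _
      rw [← sum_coord (e := e) x.1]
      refine Submodule.sum_mem _ fun j _ => ?_
      by_cases hj : j = 0 ∨ i + 1 < (j : ℕ)
      · rw [hx.2 j hj, zero_smul]; exact Submodule.zero_mem _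
      · push Not at hj
        refine Submodule.smul_mem _ _ (Submodule.subset_span ⟨⟨j - 1, by omega⟩, ?_⟩)
        have h0 : (j : ℕ) ≠ 0 := fun h => hj.1 (Fin.ext h)
        simp only [v]
        congr 1
        ext
        simp only [Fin.val_succ, Fin.val_castLE]
        omega
    · rw [Submodule.span_le]
      rintro _ ⟨k, rfl⟩
      have h1 := toSph_basis_mem_truncationFace he (i := i)
        (Fin.castLE (Nat.succ_le_of_lt hi) k) (by simp only [Fin.val_castLE]; omega)
      have h2 := Submodule.smul_mem (Submodule.span ℝ ((fun x : Sph d => x.1) ''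
        truncationFace K e i)) ‖v k‖ (Submodule.subset_span ⟨_, h1, rfl⟩)
      have h3 : ‖v k‖ ≠ 0 := norm_ne_zero_iff.2 (e.ne_zero _)
      simp only [coe_toSph] at h2
      rwa [smul_smul, mul_inv_cancel₀ h3, one_smul] at h2
  unfold HasSphDim
  rw [hspan, finrank_span_eq_card hli, Fintype.card_fin]

lemma isPartialFlag_truncationFace (hK : IsSphConvex K)
    (he : ∀ j : Fin d, e j.succ ∈ interior (coneOver K)) (s : ℕ) :
    IsPartialFlag (truncation K e) s (truncationFace K e) := by
  refine ⟨fun i _ hi => ⟨isFace_truncationFace hK i, hasSphDim_truncationFace he hi⟩,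
    fun i _ hi => ?_⟩
  have hsub : truncationFace K e i ⊆ truncationFace K e (i + 1) := fun x hx =>
    ⟨hx.1, fun j hj => hx.2 j (hj.imp_right fun h => by omega)⟩
  -- The direction of `e (i + 2)` belongs only to the larger face.
  refine (Set.ssubset_iff_of_subset hsub).2
    ⟨_, toSph_basis_mem_truncationFace he (i := i + 1) ⟨i + 1, hi⟩ le_rfl, fun h => ?_⟩
  have h1 := h.2 (Fin.succ ⟨i + 1, hi⟩) (Or.inr (by simp))
  rw [coe_toSph, map_smul, coord_basis, if_pos rfl, smul_eq_mul, mul_one, inv_eq_zero,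
    norm_eq_zero] at h1
  exact e.ne_zero _ h1

lemma truncationFace_subset_frontier (hK : IsCompact K) (i : ℕ) :
    truncationFace K e i ⊆ frontier (truncation K e) := by
  intro x hx
  rw [frontier_eq_diff (isCompact_truncation hK)]
  refine ⟨hx.1, fun hxi => ?_⟩
  have := pos_of_mem_interior (coord_ne_zero 0) (nonneg_on_coneOver fun y hy => hy.2 0)
    (coe_mem_interior_coneOver.2 hxi)
  exact this.ne' (hx.2 0 (Or.inl rfl))

lemma exists_finset_truncation_eq (K : Set (Sph d))
    (e : Basis (Fin (d + 1)) ℝ (EuclideanSpace ℝ (Fin (d + 1)))) :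
    ∃ N : Finset (Sph d), truncation K e = K ∩ ⋂ n ∈ N, closedHemisphere n ∧
      ∃ n ∈ N, ∀ x : Sph d, e.coord 0 x.1 = 0 → x ∈ greatSphere n := by
  classical
  choose n c hc hn using fun i => exists_sph_inner_eq (e.coord i) (coord_ne_zero i)
  refine ⟨Finset.univ.image n, ?_, n 0, by simp, fun x hx => ?_⟩
  · ext x
    have : ∀ i, 0 ≤ c i * e.coord i x.1 ↔ 0 ≤ e.coord i x.1 := fun i =>
      mul_nonneg_iff_of_pos_left (hc i)
    simp only [truncation, closedHemisphere, Set.mem_ofPred_eq, Set.mem_inter_iff, Set.mem_iInter,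
      Finset.mem_image, Finset.mem_univ, true_and, forall_exists_index, forall_apply_eq_imp_iff,
      hn, this]
  · change ⟪(n 0).1, x.1⟫ = 0
    rw [hn, hx, mul_zero]

end Truncation

/-! ### An exposed point and its caps -/

lemma not_subset_singleton_of_isConvexBody (hd : 0 < d) {K : Set (Sph d)} (hK : IsConvexBody K)
    (p : Sph d) : ¬ K ⊆ {p} := by
  intro h
  obtain ⟨w, hw0, hw, -⟩ := exists_ne_zero_inner_nonneg hd p ∅ (by simp)
  obtain ⟨z, hz⟩ := hK.2.2
  have hf : innerₗ (EuclideanSpace ℝ (Fin (d + 1))) w ≠ 0 := by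
    intro hf
    have h1 : ⟪w, w⟫ = 0 := by rw [← innerₗ_apply_apply, hf, LinearMap.zero_apply]
    exact hw0 (inner_self_eq_zero.1 h1)
  have hK0 : ∀ x ∈ K, ⟪w, x.1⟫ = 0 := fun x hx => by
    rw [Set.mem_singleton_iff.1 (h hx), real_inner_comm]; exact hw
  exact (pos_of_mem_interior hf (nonneg_on_coneOver fun x hx => (hK0 x hx).ge)
    (coe_mem_interior_coneOver.2 hz)).ne' (hK0 z (interior_subset hz))

/-- The points of `K` farthest from the centre of a hemisphere containing `K` are exposed; the
supporting functional detects the distance to such a point. -/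
lemma exists_supporting_functional (hd : 0 < d) {K : Set (Sph d)} (hK : IsConvexBody K) :
    ∃ p ∈ K, ∃ n : Sph d, ∃ g : EuclideanSpace ℝ (Fin (d + 1)), ∃ α : ℝ, 0 < α ∧ g ≠ 0 ∧
      ⟪g, p.1⟫ = 0 ∧ ∀ x ∈ K, 0 < ⟪n.1, x.1⟫ ∧ α * (1 - ⟪p.1, x.1⟫) ≤ ⟪g, x.1⟫ := by
  obtain ⟨n, hn⟩ := hK.2.1.1
  obtain ⟨p, hpK, hp⟩ := hK.1.exists_isMinOn (hK.2.2.mono interior_subset)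
    (f := fun x : Sph d => ⟪n.1, x.1⟫) (by fun_prop)
  have hα : 0 < ⟪n.1, p.1⟫ := hn hpK
  have key : ∀ x ∈ K, ⟪n.1, p.1⟫ * (1 - ⟪p.1, x.1⟫) ≤ ⟪n.1 - ⟪n.1, p.1⟫ • p.1, x.1⟫ := by
    intro x hx
    have h1 : ⟪n.1, p.1⟫ ≤ ⟪n.1, x.1⟫ := hp hx
    rw [inner_sub_left, real_inner_smul_left]
    linarith
  refine ⟨p, hpK, n, n.1 - ⟪n.1, p.1⟫ • p.1, ⟪n.1, p.1⟫, hα, fun h0 => ?_, ?_,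
    fun x hx => ⟨hn hx, key x hx⟩⟩
  · refine not_subset_singleton_of_isConvexBody hd hK p fun x hx => ?_
    have h1 := key x hx
    rw [h0, inner_zero_left] at h1
    have h2 := nonpos_of_mul_nonpos_right h1 hα
    have h3 := real_inner_le_norm p.1 x.1
    rw [norm_coe_sph, norm_coe_sph] at h3
    have h4 : ⟪p.1, x.1⟫ = 1 := by linarith
    rw [inner_eq_one_iff_of_norm_eq_one (norm_coe_sph p) (norm_coe_sph x)] at h4
    exact Subtype.ext h4.symm
  · rw [inner_sub_left, real_inner_smul_left, inner_coe_self, mul_one, sub_self]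

lemma isExposedPoint_of_functional {K : Set (Sph d)} {p : Sph d} (hp : p ∈ K)
    {g : EuclideanSpace ℝ (Fin (d + 1))} {α : ℝ} (hα : 0 < α) (hg : g ≠ 0) (hgp : ⟪g, p.1⟫ = 0)
    (h : ∀ x ∈ K, α * (1 - ⟪p.1, x.1⟫) ≤ ⟪g, x.1⟫) : IsExposedPoint K p := by
  have hle : ∀ x : Sph d, ⟪p.1, x.1⟫ ≤ 1 := fun x => by
    have h3 := real_inner_le_norm p.1 x.1
    rwa [norm_coe_sph, norm_coe_sph, one_mul] at h3
  have hc : 0 < ‖g‖⁻¹ := inv_pos.2 (norm_pos_iff.2 hg)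
  have hn : ∀ x, ⟪(toSph g hg).1, x⟫ = ‖g‖⁻¹ * ⟪g, x⟫ := fun x => by
    rw [coe_toSph, real_inner_smul_left]
  refine ⟨toSph g hg, fun x hx => ?_, Set.Subset.antisymm ?_ ?_⟩
  · change 0 ≤ ⟪(toSph g hg).1, x.1⟫
    rw [hn]
    exact mul_nonneg hc.le ((mul_nonneg hα.le (sub_nonneg.2 (hle x))).trans (h x hx))
  · rintro x ⟨hx, hx0⟩
    have h0 : ⟪(toSph g hg).1, x.1⟫ = 0 := hx0
    rw [hn] at h0
    have h1 := h x hx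
    rw [(mul_eq_zero.1 h0).resolve_left hc.ne'] at h1
    have h2 := nonpos_of_mul_nonpos_right h1 hα
    have h4 : ⟪p.1, x.1⟫ = 1 := le_antisymm (hle x) (by linarith)
    rw [inner_eq_one_iff_of_norm_eq_one (norm_coe_sph p) (norm_coe_sph x)] at h4
    exact Subtype.ext h4.symm
  · rintro x rfl
    refine ⟨hp, ?_⟩
    change ⟪(toSph g hg).1, x.1⟫ = 0
    rw [hn, hgp, mul_zero]

lemma exists_mem_openCap_of_lt {ε : ℝ} (hε : 0 < ε) (p : Sph d) :
    ∃ γ : ℝ, 0 < γ ∧ ∀ x : Sph d, 1 - ⟪p.1, x.1⟫ < γ → x ∈ openCap p ε := by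
  have h0 : 0 < min ε Real.pi := lt_min hε Real.pi_pos
  have h1 := Real.cos_lt_cos_of_nonneg_of_le_pi le_rfl (min_le_right ε Real.pi) h0
  rw [Real.cos_zero] at h1
  refine ⟨1 - Real.cos (min ε Real.pi), by linarith, fun x hx => ?_⟩
  change InnerProductGeometry.angle p.1 x.1 < ε
  refine lt_of_lt_of_le ?_ (min_le_left ε Real.pi)
  by_contra! hle
  have h2 := Real.cos_le_cos_of_nonneg_of_le_pi h0.le (InnerProductGeometry.angle_le_pi _ _) hle
  rw [InnerProductGeometry.cos_angle, norm_coe_sph, norm_coe_sph, mul_one, div_one] at h2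
  linarith

/-! ### Choosing the simplicial cone -/

/-- An open set meeting the kernel of a functional contains a basis of the kernel; every point at
height one completes it to a basis. -/
lemma exists_basis_in_ker {h : EuclideanSpace ℝ (Fin (d + 1)) →ₗ[ℝ] ℝ} (h0 : h ≠ 0)
    {U : Set (EuclideanSpace ℝ (Fin (d + 1)))} (hU : IsOpen U)
    {c : EuclideanSpace ℝ (Fin (d + 1))} (hc : c ∈ U) (hhc : h c = 0) :
    ∃ v : Fin d → EuclideanSpace ℝ (Fin (d + 1)), (∀ j, v j ∈ U ∧ h (v j) = 0) ∧
      ∀ y, h y = 1 → ∃ e : Basis (Fin (d + 1)) ℝ (EuclideanSpace ℝ (Fin (d + 1))),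
        e 0 = y ∧ ∀ j, e (Fin.succ j) = v j := by
  have hspan : ⊤ ≤ Submodule.span ℝ ((fun x : LinearMap.ker h => x.1) ⁻¹' U) := by
    refine (Submodule.eq_top_of_nonempty_interior' _ ⟨⟨c, hhc⟩, ?_⟩).ge
    exact interior_maximal Submodule.subset_span (hU.preimage continuous_subtype_val) hc
  have hdim : finrank ℝ (LinearMap.ker h) = d := by
    have h1 := LinearMap.finrank_range_add_finrank_ker h
    rw [LinearMap.range_eq_top.2 (LinearMap.surjective h0), finrank_top, finrank_self,
      finrank_euclideanSpace_fin] at h1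
    omega
  let b := (Basis.ofSpan hspan).reindex
    ((Basis.ofSpan hspan).indexEquiv (finBasisOfFinrankEq ℝ (LinearMap.ker h) hdim))
  have hb : ∀ j, (b j).1 ∈ U := fun j => by
    have : b j ∈ Set.range (Basis.ofSpan hspan) := by
      simp only [b, Basis.reindex_apply]; exact ⟨_, rfl⟩
    exact Basis.ofSpan_subset hspan this
  refine ⟨fun j => (b j).1, fun j => ⟨hb j, (b j).2⟩, fun y hy => ?_⟩
  refine ⟨Basis.mkFinCons y b ?_ ?_, ?_, fun j => ?_⟩
  · intro a x hx hax
    have h1 := congrArg h hax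
    rwa [map_add, map_smul, hy, LinearMap.mem_ker.1 hx, map_zero, add_zero, smul_eq_mul,
      mul_one] at h1
  · intro z
    refine ⟨-h z, ?_⟩
    rw [LinearMap.mem_ker, map_add, map_smul, hy, smul_eq_mul, mul_one, add_neg_cancel]
  · rw [Basis.coe_mkFinCons, Fin.cons_zero]
  · rw [Basis.coe_mkFinCons, Fin.cons_succ]; rfl

/-- Among the bases extending a basis of `ker h` by a point at height one there are bases whose
truncations cut off only points at small height. -/
lemma exists_basis_height_lt {h : EuclideanSpace ℝ (Fin (d + 1)) →ₗ[ℝ] ℝ} (h0 : h ≠ 0)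
    {U : Set (EuclideanSpace ℝ (Fin (d + 1)))} (hU : IsOpen U)
    {c : EuclideanSpace ℝ (Fin (d + 1))} (hc : c ∈ U) (hhc : h c = 0) {γ : ℝ} (hγ : 0 < γ) :
    ∃ e : Basis (Fin (d + 1)) ℝ (EuclideanSpace ℝ (Fin (d + 1))), e.coord 0 = h ∧
      (∀ j : Fin d, e j.succ ∈ U) ∧ ∀ x : Sph d, (∃ i, e.coord i x.1 < 0) → h x.1 < γ := by
  obtain ⟨v, hv, hext⟩ := exists_basis_in_ker h0 hU hc hhc
  obtain ⟨y, hy⟩ := LinearMap.surjective h0 1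
  obtain ⟨b, hb0, hb⟩ := hext y hy
  set A : ℝ := 1 + ∑ j : Fin d, ‖LinearMap.toContinuousLinearMap (b.coord j.succ)‖ with hA
  have hA0 : 0 < A := by positivity
  have hbA : ∀ (j : Fin d) (x : Sph d), -b.coord j.succ x.1 ≤ A := by
    intro j x
    have h1 := (LinearMap.toContinuousLinearMap (b.coord j.succ)).le_opNorm x.1
    rw [norm_coe_sph, mul_one] at h1
    have h2 := Finset.single_le_sum
      (f := fun j : Fin d => ‖LinearMap.toContinuousLinearMap (b.coord j.succ)‖)
      (fun j _ => norm_nonneg _) (Finset.mem_univ j)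
    have h3 : -b.coord j.succ x.1 ≤ ‖LinearMap.toContinuousLinearMap (b.coord j.succ) x.1‖ :=
      neg_le_abs _
    have h4 : ‖LinearMap.toContinuousLinearMap (b.coord j.succ)‖ ≤
      ∑ j : Fin d, ‖LinearMap.toContinuousLinearMap (b.coord j.succ)‖ := h2
    linarith
  -- Replacing `y` by `y - R ∑ v j` adds `R h` to each other coordinate. These were at least `-A` on
  -- the sphere, so they can be negative only where `h < A / R = γ`.
  set R : ℝ := A / γ with hR
  have hR0 : 0 < R := div_pos hA0 hγ
  obtain ⟨e, he0, he⟩ := hext (y - R • ∑ j, v j) (by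
    rw [map_sub, map_smul, map_sum, Finset.sum_eq_zero fun j _ => (hv j).2, smul_zero, sub_zero,
      hy])
  have heh : e.coord 0 = h := by
    refine e.ext fun i => ?_
    induction i using Fin.cases with
    | zero =>
      rw [coord_basis, if_pos rfl, he0, map_sub, map_smul, map_sum,
        Finset.sum_eq_zero fun j _ => (hv j).2, smul_zero, sub_zero, hy]
    | succ j => rw [coord_basis, if_neg (Fin.succ_ne_zero j), he, (hv j).2]
  have hej : ∀ j : Fin d, e.coord j.succ = b.coord j.succ + R • h := by
    intro j
    refine e.ext fun i => ?_
    rw [LinearMap.add_apply, LinearMap.smul_apply, ← heh, coord_basis, coord_basis]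
    induction i using Fin.cases with
    | zero =>
      rw [he0, ← hb0]
      simp only [← hb, map_sub, map_smul, map_sum, coord_basis]
      simp [(Fin.succ_ne_zero j).symm]
    | succ i => simp [he, ← hb, coord_basis, -Basis.coord_apply]
  refine ⟨e, heh, fun j => he j ▸ (hv j).1, ?_⟩
  rintro x ⟨i, hi⟩
  induction i using Fin.cases with
  | zero => rw [heh] at hi; exact hi.trans hγ
  | succ j =>
    rw [hej, LinearMap.add_apply, LinearMap.smul_apply, smul_eq_mul] at hi
    have h1 := hbA j x
    have h2 : R * h x.1 < R * γ := by
      rw [hR, div_mul_cancel₀ _ hγ.ne', ← hR]; linarith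
    exact lt_of_mul_lt_mul_left h2 hR0.le

end SphericalIllumination

/-! ### Assembling the truncation -/

theorem mainTheorem5 (d : ℕ) (hd : 2 < d) (K : Set (Sph d)) (hK : IsConvexBody K)
    (ε : ℝ) (hε : 0 < ε) :
    ∃ K' : Set (Sph d), IsConvexBody K' ∧ K' ⊆ K ∧
      illuminationNumber K' = (d : ℕ∞) + 1 ∧
      ∃ p : Sph d, IsExposedPoint K p ∧ p ∉ K' ∧ K \ K' ⊆ openCap p ε ∧
        ∃ N : Finset (Sph d), K' = K ∩ ⋂ n ∈ N, closedHemisphere n ∧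
          ∃ F : ℕ → Set (Sph d), IsPartialFlag K' 2 F ∧
            ∃ n ∈ N, ∀ i, 2 ≤ i → i < d → F i ⊆ frontier K' ∩ greatSphere n := by
  have hd0 : 0 < d := by omega
  obtain ⟨p, hpK, n, g, α, hα, hg0, hgp, hK2⟩ := exists_supporting_functional hd0 hK
  obtain ⟨γ, hγ, hcap⟩ := exists_mem_openCap_of_lt hε p
  obtain ⟨w, hw⟩ := hK.2.2
  have hnK : ∀ x ∈ K, 0 < inner ℝ n.1 x.1 := fun x hx => (hK2 x hx).1
  have hn1 : ∀ x : Sph d, inner ℝ n.1 x.1 ≤ 1 := fun x => by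
    have h3 := real_inner_le_norm n.1 x.1
    rwa [norm_coe_sph, norm_coe_sph, one_mul] at h3
  have hp1 : ∀ x : Sph d, inner ℝ p.1 x.1 ≤ 1 := fun x => by
    have h3 := real_inner_le_norm p.1 x.1
    rwa [norm_coe_sph, norm_coe_sph, one_mul] at h3
  have hgw : 0 < inner ℝ g w.1 := by
    refine pos_of_mem_interior (f := innerₗ _ g) (fun hf => hg0 ?_)
      (nonneg_on_coneOver fun x hx => ?_) (coe_mem_interior_coneOver.2 hw)
    · have h1 : inner ℝ g g = 0 := by rw [← innerₗ_apply_apply, hf, LinearMap.zero_apply]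
      exact inner_self_eq_zero.1 h1
    · exact (mul_nonneg hα.le (sub_nonneg.2 (hp1 x))).trans (hK2 x hx).2
  -- The cut is the zero set of `g - τ n`. The bound `τ < ⟪g, w⟫` keeps `w` on the positive side; `τ
  -- < α γ / 2` and the height bound `α γ / 2` together give `α (1 - ⟪p, x⟫) < α γ` on the removed
  -- part.
  obtain ⟨τ, hτ, hτlt⟩ := exists_between (lt_min (half_pos (mul_pos hα hγ)) hgw)
  obtain ⟨hτ1, hτ2⟩ := lt_min_iff.1 hτlt
  let h : EuclideanSpace ℝ (Fin (d + 1)) →ₗ[ℝ] ℝ := innerₗ _ (g - τ • n.1)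
  have hh : ∀ x, h x = inner ℝ g x - τ * inner ℝ n.1 x := fun x => by simp [h]
  have hhp : h p.1 < 0 := by
    rw [hh, hgp, zero_sub]
    exact neg_neg_of_pos (mul_pos hτ (hnK p hpK))
  have hhw : 0 < h w.1 := by
    rw [hh]
    have := mul_le_mul_of_nonneg_left (hn1 w) hτ.le
    linarith
  have hh0 : h ≠ 0 := fun h0 => by rw [h0] at hhw; exact lt_irrefl _ hhw
  -- The arc from `p` to `w` crosses the cut at an interior point of `K`, around which the
  -- generators of the facet are chosen.
  have hc : h w.1 • p.1 + (-h p.1) • w.1 ∈ interior (coneOver K) :=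
    add_mem_interior_coneOver hK.2.1 (smul_mem_coneOver hhw.le (coe_mem_coneOver.2 hpK))
      (smul_mem_interior_coneOver (neg_pos.2 hhp) (coe_mem_interior_coneOver.2 hw))
  obtain ⟨e, he0, he, hlt⟩ := exists_basis_height_lt hh0 isOpen_interior hc
    (by rw [map_add, map_smul, map_smul, smul_eq_mul, smul_eq_mul]; ring)
    (half_pos (mul_pos hα hγ))
  obtain ⟨N, hN, m, hmN, hm⟩ := exists_finset_truncation_eq K e
  refine ⟨truncation K e, isConvexBody_truncation hd0 hK he, fun x hx => hx.1,
    illuminationNumber_truncation hd0 hK he, p,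
    isExposedPoint_of_functional hpK hα hg0 hgp fun x hx => (hK2 x hx).2, fun hp => ?_, ?_,
    N, hN, truncationFace K e, isPartialFlag_truncationFace hK.2.1 he 2, m, hmN,
    fun i _ _ x hx => ⟨truncationFace_subset_frontier hK.1 i hx, hm x (hx.2 0 (Or.inl rfl))⟩⟩
  · have := hp.2 0
    rw [he0] at this
    exact this.not_gt hhp
  · rintro x ⟨hxK, hx⟩
    have hneg : ∃ i, e.coord i x.1 < 0 := by
      by_contra! H
      exact hx ⟨hxK, H⟩
    have h1 := hlt x hneg
    rw [hh] at h1
    have h2 := mul_le_mul_of_nonneg_left (hn1 x) hτ.le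
    exact hcap x (lt_of_mul_lt_mul_left (by linarith [(hK2 x hxK).2]) hα.le)
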